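/- Let $N\ge 1$ objects with absolute ranks $1,\dots,N$ (1 is the best) appear one by one in uniformly random order at moments $1,\dots,N$; the relative rank $R_n$ is the rank of the $n$-th object among the first $n$. Let $u_N=0$ and $u_n=\frac1{n+1}\max\{\frac{n+1}{N},u_{n+1}\}+\frac{n}{n+1}u_{n+1}$ for $0\le n<N$, and let $n^*$ be the smallest $n$ with $n/N\ge u_n$. Player 1 plays her optimal strategy in the classical secretary problem: she takes the first object of relative rank 1 appearing at or after moment $n^*$. Player 2 then sees all the other objects in the same order; he observes only the rank of each object among those he has seen so far, may accept at most one object, only when it appears, and his reward is 1 if it has absolute rank 1, otherwise 0. A candidate is an object that is the best Player 2 has seen so far; a decision point is the appearance of a candidate. For a possible history $h$ of Player 2 ending at a decision point, let $p_h$ be the conditional probability, given $h$, that the current candidate has relative rank 1 among all objects that have appeared (this is $p_{m,n,H}$ when the candidate is the $m$-th one seen after moment $n^*$ and appears at moment $n$). For $n^*<n\le N$ let $$q_n=\frac{S_{2,n}}{1+S_{2,n}-S_{1,n}},\qquad S_{1,n}=\sum_{k=n+1}^N\frac1{k-1},\qquad S_{2,n}=\sum_{k=n+1}^N\frac{n-1}{(k-1)(k-2)}.$$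 The one-step look-ahead (OSLA) rule accepts a candidate if and only if the conditional expected reward from accepting it is at least the conditional expected reward from rejecting it and accepting the next candidate that appears (reward 0 if there is none). Then, for decision points from $n^*$ on, i.e. those at which the candidate is the $j$-th object seen by Player 2 with $j\ge n^*$: (i) the candidate necessarily appears at moment $n=j+1\le N$, so Player 2 knows $n>n^*$; (ii) $q_n$ is strictly decreasing in $n$ for $n^*<n\le N$, and $p_h$ strictly increases from a decision point to any later one; (iii) the OSLA rule accepts the candidate at moment $n$ with history $h$ if and only if $p_h\ge q_n$; (iv) the stopping sets are closed: if the OSLA rule accepts at a decision point, it accepts at every later decision point; (v) the OSLA rule is optimal: given any history of Player 2 consisting of at least $n^*$ seen objects of which all but the last have been rejected, no strategy from there on has a larger conditional expected reward than the OSLA rule; in particular, replacing any strategy of Player 2 by the OSLA rule from the $n^*$-th object he sees onward does not decrease his expected reward in the whole game. Moreover, accepting a candidate at moment $n$ is optimal (its expected reward is at least that of every continuation after rejection) if and only if $p_h\ge q_n$. -/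

import Mathlib

open Finset

noncomputable section

namespace SecretaryGame

/-! `N` objects appear in uniformly random order: the sample space is the set of all permutations
`ω` of `Fin N` with the uniform distribution. Moments are counted from `1` to `N`. -/

/-- The absolute rank (`1` is the best) of the object appearing at moment `n`, `1 ≤ n ≤ N`. -/
def absRank {N : ℕ} (ω : Equiv.Perm (Fin N)) (n : ℕ) : ℕ :=
  if h : 0 < n ∧ n ≤ N then (ω ⟨n - 1, by omega⟩ : ℕ) + 1 else 0

/-- The relative rank of the object appearing at moment `n` among the first `n` objects. -/
def relRank {N : ℕ} (ω : Equiv.Perm (Fin N)) (n : ℕ) : ℕ :=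
  #{i ∈ Icc 1 n | absRank ω i ≤ absRank ω n}

/-- Conditional probability `P(E | F)` under the uniform distribution on permutations. -/
def condProb {N : ℕ} (E F : Set (Equiv.Perm (Fin N))) : ℝ :=
  ((E ∩ F).ncard : ℝ) / (F.ncard : ℝ)

/-! ### Player 1: the classical secretary problem -/

/-- The optimal probability that Player 1 selects the best object after having rejected
the first `n` objects (backward induction, zero after the last object). -/
def u (N n : ℕ) : ℝ :=
  if n < N then
    1 / ((n : ℝ) + 1) * max (((n : ℝ) + 1) / N) (u N (n + 1))
      + (n : ℝ) / ((n : ℝ) + 1) * u N (n + 1)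
  else 0
termination_by N - n

/-- Player 1's threshold `n*`: the smallest `n` with `n / N ≥ u_n`. -/
def nStar (N : ℕ) : ℕ := sInf {n : ℕ | u N n ≤ (n : ℝ) / N}

/-- The moment at which Player 1 accepts an object: the first moment from `n*` on at which an
object of relative rank 1 appears, and `N + 1` if there is no such moment. -/
def mu0 {N : ℕ} (ω : Equiv.Perm (Fin N)) : ℕ :=
  sInf ({n : ℕ | nStar N ≤ n ∧ n ≤ N ∧ relRank ω n = 1} ∪ {N + 1})

/-! ### Player 2: he sees all objects except the one taken by Player 1, in the same order -/

/-- The number of objects that Player 2 sees. -/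
def numSeen {N : ℕ} (ω : Equiv.Perm (Fin N)) : ℕ := if mu0 ω ≤ N then N - 1 else N

/-- The moment at which the `j`-th object seen by Player 2 appears. -/
def seenAt {N : ℕ} (ω : Equiv.Perm (Fin N)) (j : ℕ) : ℕ := if j < mu0 ω then j else j + 1

/-- The rank of the `j`-th object seen by Player 2 among the first `j` objects seen by him. -/
def seenRank {N : ℕ} (ω : Equiv.Perm (Fin N)) (j : ℕ) : ℕ :=
  #{i ∈ Icc 1 j | absRank ω (seenAt ω i) ≤ absRank ω (seenAt ω j)}

/-- What Player 2 knows after seeing `j` objects: their successive ranks. -/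
def hist {N : ℕ} (ω : Equiv.Perm (Fin N)) (j : ℕ) : List ℕ :=
  (List.range j).map fun i => seenRank ω (i + 1)

/-- The event that the first `h.length` objects seen by Player 2 give the history `h`. -/
def event (N : ℕ) (h : List ℕ) : Set (Equiv.Perm (Fin N)) :=
  {ω | h.length ≤ numSeen ω ∧ hist ω h.length = h}

/-- The last object in the history is a candidate, i.e. the best one seen so far by Player 2. -/
def EndsWithCandidate (h : List ℕ) : Prop := h.getLast? = some 1

/-- `h` is a history of Player 2 that can occur and that ends at a decision point. -/
def IsDecisionPoint (N : ℕ) (h : List ℕ) : Prop :=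
  (event N h).Nonempty ∧ EndsWithCandidate h

/-- A decision rule of Player 2: the set of histories at which he accepts the current object
(if he has not accepted an earlier one). -/
abbrev Strategy : Type := Set (List ℕ)

/-- Player 2 selects the best of all objects when he uses `σ` starting from the `k`-th object
seen by him, having rejected the earlier ones. -/
def WinsFrom {N : ℕ} (σ : Strategy) (k : ℕ) (ω : Equiv.Perm (Fin N)) : Prop :=
  ∃ i, k ≤ i ∧ i ≤ numSeen ω ∧ hist ω i ∈ σ ∧ (∀ l, k ≤ l → l < i → hist ω l ∉ σ) ∧
    absRank ω (seenAt ω i) = 1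

/-- The expected reward of Player 2, given the history `h`, when he uses `σ` starting from the
`k`-th object seen by him. -/
def value (N : ℕ) (σ : Strategy) (k : ℕ) (h : List ℕ) : ℝ :=
  condProb {ω | WinsFrom σ k ω} (event N h)

/-- The expected reward from accepting the last object of the history `h`. -/
def stopReward (N : ℕ) (h : List ℕ) : ℝ :=
  condProb {ω | absRank ω (seenAt ω h.length) = 1} (event N h)

/-- The expected reward from rejecting the last object of the history `h` and accepting the next
candidate to appear to Player 2 (zero if there is none). -/
def nextReward (N : ℕ) (h : List ℕ) : ℝ :=
  value N {g | EndsWithCandidate g} (h.length + 1) h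

/-- The one-step look-ahead rule: accept a candidate whenever this is at least as good as
accepting the next candidate. -/
def osla (N : ℕ) : Strategy := {h | EndsWithCandidate h ∧ nextReward N h ≤ stopReward N h}

/-- Follow `σ` for the first `n* - 1` objects and the one-step look-ahead rule afterwards. -/
def thenOsla (N : ℕ) (σ : Strategy) : Strategy :=
  {h | (h.length < nStar N ∧ h ∈ σ) ∨ (nStar N ≤ h.length ∧ h ∈ osla N)}

/-- The probability that the last object of the history `h` of Player 2 has relative rank 1
among all objects that have appeared, including the one taken by Player 1, given `h`. -/
def p (N : ℕ) (h : List ℕ) : ℝ :=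
  condProb {ω | relRank ω (seenAt ω h.length) = 1} (event N h)

/-! ### The thresholds -/

def S1 (N n : ℕ) : ℝ := ∑ k ∈ Icc (n + 1) N, 1 / ((k : ℝ) - 1)

def S2 (N n : ℕ) : ℝ := ∑ k ∈ Icc (n + 1) N, ((n : ℝ) - 1) / (((k : ℝ) - 1) * ((k : ℝ) - 2))

/-- The threshold `q_n`. -/
def q (N n : ℕ) : ℝ := S2 N n / (1 + S2 N n - S1 N n)

end SecretaryGame

end

/-! The relative ranks of the objects are independent and uniform. Once Player 1 has taken her
object, Player 2's posterior probability that it is the best so far is therefore divided by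
`1 + P(it has rank r | h)` when he observes the rank `r`. The divisor exceeds `1` when he sees a
candidate, so `p` increases from one decision point to the next. Acceptance by the one-step
look-ahead rule means `q_n ≤ p`, and `q_n` decreases, so the stopping sets of this rule are closed.
This is the monotone case of optimal stopping: at an accepted history all later candidates are
accepted as well, so continuing is worth no more than taking the next candidate, and backward
induction shows that no rule does better. -/

namespace SecretaryGame

variable {N : ℕ} {ω ω' : Equiv.Perm (Fin N)}

/-! ### Ranks among the first objects -/

theorem absRank_eq {i : ℕ} (h1 : 1 ≤ i) (hN : i ≤ N) :
    absRank ω i = (ω ⟨i - 1, by omega⟩ : ℕ) + 1 :=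
  dif_pos ⟨h1, hN⟩

theorem absRank_bijOn (ω : Equiv.Perm (Fin N)) :
    Set.BijOn (absRank ω) (Set.Icc 1 N) (Set.Icc 1 N) := by
  refine ⟨fun i hi => ?_, fun i hi j hj h => ?_, fun r hr => ?_⟩
  · rw [absRank_eq hi.1 hi.2]
    exact ⟨by omega, (ω _).isLt⟩
  · rw [absRank_eq hi.1 hi.2, absRank_eq hj.1 hj.2] at h
    have hij := congrArg Fin.val (ω.injective (Fin.ext (Nat.succ_injective h)))
    simp only [Set.mem_Icc] at hij hi hj
    omega
  · obtain ⟨x, hx⟩ := ω.surjective ⟨r - 1, by have := hr.1; have := hr.2; omega⟩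
    refine ⟨x + 1, ⟨by omega, x.isLt⟩, ?_⟩
    rw [absRank_eq (by omega) x.isLt]
    exact (congrArg (fun y : Fin N => (y : ℕ) + 1) hx).trans (Nat.sub_add_cancel hr.1)

/-- The rank of the `i`-th object among the first `n` objects, so that `relRank ω n` is
`rankAmong ω n n`; for `n < i` it counts the objects among the first `n` that are better than the
`i`-th one. -/
def rankAmong (ω : Equiv.Perm (Fin N)) (n i : ℕ) : ℕ :=
  #{k ∈ Icc 1 n | absRank ω k ≤ absRank ω i}

theorem rankAmong_le_rankAmong_iff {n i j : ℕ} (h1 : 1 ≤ i) (hin : i ≤ n) :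
    rankAmong ω n i ≤ rankAmong ω n j ↔ absRank ω i ≤ absRank ω j := by
  refine ⟨fun h => ?_, fun h => card_le_card fun k hk => ?_⟩
  · by_contra! hlt
    refine h.not_gt (card_lt_card ⟨fun k hk => ?_, fun hsub => ?_⟩)
    · rw [mem_filter] at hk ⊢
      exact ⟨hk.1, hk.2.trans hlt.le⟩
    · have hi := hsub (mem_filter.2 ⟨mem_Icc.2 ⟨h1, hin⟩, le_rfl⟩)
      exact hlt.not_ge (mem_filter.1 hi).2
  · rw [mem_filter] at hk ⊢
    exact ⟨hk.1, hk.2.trans h⟩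

theorem rankAmong_last {i : ℕ} (h1 : 1 ≤ i) (hN : i ≤ N) : rankAmong ω N i = absRank ω i := by
  have hbij := absRank_bijOn ω
  have hi := hbij.mapsTo ⟨h1, hN⟩
  have himage : {k ∈ Icc 1 N | absRank ω k ≤ absRank ω i}.image (absRank ω) =
      Icc 1 (absRank ω i) := by
    ext r
    simp only [mem_image, mem_filter, mem_Icc]
    constructor
    · rintro ⟨k, ⟨hk, hle⟩, rfl⟩
      exact ⟨(hbij.mapsTo hk).1, hle⟩
    · rintro ⟨hr, hle⟩
      obtain ⟨k, hk, rfl⟩ := hbij.surjOn ⟨hr, hle.trans hi.2⟩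
      exact ⟨k, ⟨hk, hle⟩, rfl⟩
  rw [rankAmong, ← card_image_of_injOn (hbij.injOn.mono fun k hk => mem_Icc.1 (mem_filter.1 hk).1),
    himage, Nat.card_Icc, Nat.add_sub_cancel]

theorem relRank_le (ω : Equiv.Perm (Fin N)) (n : ℕ) : relRank ω n ≤ n :=
  (card_filter_le _ _).trans (by simp)

theorem one_le_relRank {n : ℕ} (h1 : 1 ≤ n) : 1 ≤ relRank ω n :=
  card_pos.2 ⟨n, by simp [h1]⟩

theorem relRank_succ (n : ℕ) : relRank ω (n + 1) = rankAmong ω n (n + 1) + 1 := by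
  rw [relRank, rankAmong, ← insert_Icc_right_eq_Icc_add_one (by omega), filter_insert,
    if_pos le_rfl, card_insert_of_notMem (by simp)]

theorem absRank_succ_le_iff {n i : ℕ} (h1 : 1 ≤ i) (hin : i ≤ n) (hN : n < N) :
    absRank ω (n + 1) ≤ absRank ω i ↔ relRank ω (n + 1) ≤ rankAmong ω n i := by
  have hne : absRank ω i ≠ absRank ω (n + 1) := fun h => by
    have := (absRank_bijOn ω).injOn ⟨h1, by omega⟩ ⟨by omega, hN⟩ h
    omega
  rw [relRank_succ, Nat.succ_le_iff, ← not_iff_not, not_lt, rankAmong_le_rankAmong_iff h1 hin,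
    not_le, hne.le_iff_lt]

theorem rankAmong_succ {n i : ℕ} (h1 : 1 ≤ i) (hin : i ≤ n) (hN : n < N) :
    rankAmong ω (n + 1) i =
      rankAmong ω n i + if relRank ω (n + 1) ≤ rankAmong ω n i then 1 else 0 := by
  simp only [← absRank_succ_le_iff h1 hin hN]
  rw [rankAmong, ← insert_Icc_right_eq_Icc_add_one (by omega), filter_insert]
  split_ifs with h
  · rw [card_insert_of_notMem (by simp), rankAmong]
  · rw [rankAmong, Nat.add_zero]

theorem one_le_rankAmong {n i : ℕ} (h1 : 1 ≤ i) (hin : i ≤ n) : 1 ≤ rankAmong ω n i :=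
  card_pos.2 ⟨i, by simp [h1, hin]⟩

theorem rankAmong_eq_one_iff {n m i : ℕ} (h1 : 1 ≤ i) (hin : i ≤ n) (hnm : n ≤ m) (hN : m ≤ N) :
    rankAmong ω m i = 1 ↔ rankAmong ω n i = 1 ∧ ∀ l ∈ Ioc n m, 1 < relRank ω l := by
  induction m, hnm using Nat.le_induction with
  | base => simp
  | succ m hnm ih =>
    have hpos := one_le_rankAmong (ω := ω) h1 (hin.trans hnm)
    have hrel := one_le_relRank (ω := ω) (n := m + 1) (by omega)
    have hstep : rankAmong ω (m + 1) i = 1 ↔ rankAmong ω m i = 1 ∧ 1 < relRank ω (m + 1) := by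
      rw [rankAmong_succ h1 (hin.trans hnm) hN]
      split_ifs <;> omega
    rw [hstep, ih (by omega), and_assoc, ← insert_Ioc_right_eq_Ioc_add_one hnm,
      forall_mem_insert, and_comm (a := 1 < _)]

theorem absRank_eq_one_iff {n : ℕ} (h1 : 1 ≤ n) (hN : n ≤ N) :
    absRank ω n = 1 ↔ relRank ω n = 1 ∧ ∀ l ∈ Ioc n N, 1 < relRank ω l := by
  rw [← rankAmong_last h1 hN, rankAmong_eq_one_iff h1 le_rfl hN le_rfl]
  rfl

/-! ### Independence of the relative ranks -/

/-- The two orders of appearance give the same relative ranks up to moment `n`, that is, they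
cannot be told apart by an observer of the first `n` objects. -/
def Agree (n : ℕ) (ω ω' : Equiv.Perm (Fin N)) : Prop :=
  ∀ i ≤ n, relRank ω i = relRank ω' i

theorem Agree.symm {n : ℕ} (h : Agree n ω ω') : Agree n ω' ω :=
  fun i hi => (h i hi).symm

theorem Agree.mono {m n : ℕ} (h : Agree n ω ω') (hmn : m ≤ n) : Agree m ω ω' :=
  fun i hi => h i (hi.trans hmn)

theorem Agree.rankAmong_eq {n m i : ℕ} (h : Agree n ω ω') (hN : n ≤ N) (h1 : 1 ≤ i) (him : i ≤ m)
    (hmn : m ≤ n) : rankAmong ω m i = rankAmong ω' m i := by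
  induction m, him using Nat.le_induction with
  | base => exact h i hmn
  | succ m him ih =>
    rw [rankAmong_succ h1 him (by omega), rankAmong_succ h1 him (by omega), ih (by omega),
      h (m + 1) hmn]

theorem Agree.eq (h : Agree N ω ω') : ω = ω' := by
  ext x
  have hx : absRank ω (x + 1) = absRank ω' (x + 1) := by
    rw [← rankAmong_last (by omega) x.isLt, ← rankAmong_last (by omega) x.isLt,
      h.rankAmong_eq le_rfl (by omega) x.isLt le_rfl]
  rw [absRank_eq (by omega) x.isLt, absRank_eq (by omega) x.isLt] at hx
  exact Nat.succ_injective hx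

theorem exists_relRank_eq {r : ℕ → ℕ} (hr : ∀ i ∈ Icc 1 N, r i ∈ Icc 1 i) :
    ∃ ω : Equiv.Perm (Fin N), ∀ i ∈ Icc 1 N, relRank ω i = r i := by
  let code (ω : Equiv.Perm (Fin N)) (i : Fin N) : ℕ := relRank ω (i + 1)
  have hmaps : Set.MapsTo code (univ : Finset (Equiv.Perm (Fin N)))
      (Fintype.piFinset fun i : Fin N => Icc 1 ((i : ℕ) + 1)) := fun ω _ =>
    mem_coe.2 (Fintype.mem_piFinset.2 fun i =>
      mem_Icc.2 ⟨one_le_relRank (by omega), relRank_le ω _⟩)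
  have hinj : Function.Injective code := fun ω ω' h => Agree.eq fun i hi => by
    rcases i with _ | i
    · simp [relRank]
    · exact congrFun h ⟨i, hi⟩
  have hcard : #(Fintype.piFinset fun i : Fin N => Icc 1 ((i : ℕ) + 1)) ≤
      #(univ : Finset (Equiv.Perm (Fin N))) := by
    simp [Fintype.card_perm, Fin.prod_univ_eq_prod_range (fun i => i + 1),
      prod_range_add_one_eq_factorial]
  obtain ⟨ω, -, hω⟩ := surjOn_of_injOn_of_card_le code hmaps hinj.injOn hcard
    (mem_coe.2 (Fintype.mem_piFinset.2 fun i : Fin N => hr (i + 1) (mem_Icc.2 (by omega))))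
  refine ⟨ω, fun i hi => ?_⟩
  rw [mem_Icc] at hi
  have := congrFun hω ⟨i - 1, by omega⟩
  simpa only [code, Nat.sub_add_cancel hi.1] using this

theorem ncard_biUnion_finset {α ι : Type*} [Finite α] (t : Finset ι) {s : ι → Set α}
    (hs : (t : Set ι).PairwiseDisjoint s) : (⋃ i ∈ t, s i).ncard = ∑ i ∈ t, (s i).ncard := by
  rw [← finsum_mem_coe_finset]
  exact t.finite_toSet.ncard_biUnion (fun _ _ => Set.toFinite _) hs

theorem ncard_inter_mem_eq_sum {α β : Type*} [Finite α] (A : Set α) (f : α → β) (t : Finset β) :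
    (A ∩ {a | f a ∈ t}).ncard = ∑ c ∈ t, (A ∩ {a | f a = c}).ncard := by
  rw [← ncard_biUnion_finset t fun c _ d _ hcd => Set.disjoint_left.2 fun a hc hd =>
    hcd (hc.2.symm.trans hd.2)]
  congr 1
  ext a
  simp

/-- The event `A` is determined by the relative ranks of the first `n` objects. -/
def IsDetermined (n : ℕ) (A : Set (Equiv.Perm (Fin N))) : Prop :=
  ∀ ⦃ω ω'⦄, Agree n ω ω' → ω ∈ A → ω' ∈ A

section IsDetermined

variable {n m : ℕ} {A B : Set (Equiv.Perm (Fin N))}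

theorem IsDetermined.mono (h : IsDetermined n A) (hnm : n ≤ m) : IsDetermined m A :=
  fun _ _ ha => h (ha.mono hnm)

theorem IsDetermined.inter (hA : IsDetermined n A) (hB : IsDetermined n B) :
    IsDetermined n (A ∩ B) :=
  fun _ _ ha h => ⟨hA ha h.1, hB ha h.2⟩

theorem isDetermined_relRank (P : ℕ → Prop) :
    IsDetermined n {ω : Equiv.Perm (Fin N) | P (relRank ω n)} := fun _ _ h hω => by
  rwa [Set.mem_ofPred_eq, ← h n le_rfl]

theorem isDetermined_forall_relRank (P : ℕ → Prop) :
    IsDetermined m {ω : Equiv.Perm (Fin N) | ∀ l ∈ Ioc n m, P (relRank ω l)} :=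
  fun _ _ h hω l hl => h l (mem_Ioc.1 hl).2 ▸ hω l hl

theorem IsDetermined.ncard_inter_relRank_le {c d : ℕ} (hA : IsDetermined n A) (hn : n < N)
    (hd : d ∈ Icc 1 (n + 1)) :
    (A ∩ {ω | relRank ω (n + 1) = c}).ncard ≤ (A ∩ {ω | relRank ω (n + 1) = d}).ncard := by
  have hchange (ω : Equiv.Perm (Fin N)) : ∃ ω' : Equiv.Perm (Fin N), ∀ i ∈ Icc 1 N,
      relRank ω' i = Function.update (relRank ω) (n + 1) d i :=
    exists_relRank_eq fun i hi => by
      rw [Function.update_apply]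
      split_ifs with h
      · exact h ▸ hd
      · exact mem_Icc.2 ⟨one_le_relRank (mem_Icc.1 hi).1, relRank_le ω i⟩
  choose f hf using hchange
  have hf_self (ω) : relRank (f ω) (n + 1) = d := by
    rw [hf ω _ (mem_Icc.2 ⟨by omega, hn⟩), Function.update_self]
  have hf_ne (ω) {i : ℕ} (hi : i ≤ N) (hne : i ≠ n + 1) : relRank (f ω) i = relRank ω i := by
    rcases Nat.eq_zero_or_pos i with rfl | h1
    · simp [relRank]
    · rw [hf ω i (mem_Icc.2 ⟨h1, hi⟩), Function.update_of_ne hne]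
  refine Set.ncard_le_ncard_of_injOn f ?_ ?_
  · exact fun ω hω => ⟨hA (fun i hi => (hf_ne ω (by omega) (by omega)).symm) hω.1, hf_self ω⟩
  · refine fun ω hω τ hτ h => Agree.eq fun i hi => ?_
    by_cases hin : i = n + 1
    · exact hin ▸ hω.2.trans hτ.2.symm
    · rw [← hf_ne ω hi hin, ← hf_ne τ hi hin, h]

theorem IsDetermined.ncard_inter_relRank_mem {t : Finset ℕ} (hA : IsDetermined n A) (hn : n < N)
    (ht : t ⊆ Icc 1 (n + 1)) :
    (n + 1) * (A ∩ {ω | relRank ω (n + 1) ∈ t}).ncard = #t * A.ncard := by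
  have huniform {t : Finset ℕ} (ht : t ⊆ Icc 1 (n + 1)) :
      (A ∩ {ω | relRank ω (n + 1) ∈ t}).ncard =
        #t * (A ∩ {ω | relRank ω (n + 1) = 1}).ncard := by
    rw [ncard_inter_mem_eq_sum, sum_const_nat fun c hc => ?_]
    exact (hA.ncard_inter_relRank_le hn (by simp)).antisymm
      (hA.ncard_inter_relRank_le hn (ht hc))
  have htotal : A ∩ {ω | relRank ω (n + 1) ∈ Icc 1 (n + 1)} = A :=
    Set.inter_eq_left.2 fun ω _ => mem_Icc.2 ⟨one_le_relRank (by omega), relRank_le ω _⟩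
  have hall := huniform subset_rfl
  rw [htotal, Nat.card_Icc, Nat.add_sub_cancel] at hall
  rw [huniform ht, hall]
  ring

theorem IsDetermined.ncard_inter_relRank_eq {c : ℕ} (hA : IsDetermined n A) (hn : n < N)
    (hc : c ∈ Icc 1 (n + 1)) :
    (n + 1) * (A ∩ {ω | relRank ω (n + 1) = c}).ncard = A.ncard := by
  simpa using hA.ncard_inter_relRank_mem hn (singleton_subset_iff.2 hc)

theorem IsDetermined.ncard_inter_lt_relRank (hA : IsDetermined n A) (hn : n < N) (r : ℕ) :
    (n + 1) * (A ∩ {ω | r < relRank ω (n + 1)}).ncard = (n + 1 - r) * A.ncard := by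
  have heq : A ∩ {ω | r < relRank ω (n + 1)} = A ∩ {ω | relRank ω (n + 1) ∈ Ioc r (n + 1)} := by
    simp [relRank_le]
  rw [heq, hA.ncard_inter_relRank_mem hn fun i hi => ?_, Nat.card_Ioc]
  rw [mem_Ioc] at hi
  exact mem_Icc.2 ⟨by omega, hi.2⟩

theorem IsDetermined.ncard_inter_forall_lt_relRank (hA : IsDetermined n A) (hnm : n ≤ m)
    (hN : m ≤ N) (r : ℕ) :
    m.descFactorial r * (A ∩ {ω | ∀ l ∈ Ioc n m, r < relRank ω l}).ncard =
      n.descFactorial r * A.ncard := by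
  induction m, hnm using Nat.le_induction with
  | base => simp
  | succ m hnm ih =>
    have hsplit : A ∩ {ω | ∀ l ∈ Ioc n (m + 1), r < relRank ω l} =
        A ∩ {ω | ∀ l ∈ Ioc n m, r < relRank ω l} ∩ {ω | r < relRank ω (m + 1)} := by
      simp only [← insert_Ioc_right_eq_Ioc_add_one hnm, forall_mem_insert, Set.inter_assoc,
        ← Set.ofPred_and, and_comm]
    have hcount := ((hA.mono hnm).inter
      (isDetermined_forall_relRank (n := n) (r < ·))).ncard_inter_lt_relRank hN r
    rw [← hsplit] at hcount
    refine Nat.eq_of_mul_eq_mul_left m.succ_pos ?_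
    calc (m + 1) * ((m + 1).descFactorial r *
          (A ∩ {ω | ∀ l ∈ Ioc n (m + 1), r < relRank ω l}).ncard)
        = ((m + 1 - r) * (m + 1).descFactorial r) *
          (A ∩ {ω | ∀ l ∈ Ioc n m, r < relRank ω l}).ncard := by
            rw [mul_left_comm, hcount]; ring
      _ = (m + 1) * (n.descFactorial r * A.ncard) := by
            rw [Nat.succ_descFactorial, mul_assoc, ih (by omega)]

theorem IsDetermined.ncard_inter_absRank_eq_one (hA : IsDetermined n A) (hn : n < N) :
    N * (A ∩ {ω | absRank ω (n + 1) = 1}).ncard = A.ncard := by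
  have hsplit : A ∩ {ω | absRank ω (n + 1) = 1} = A ∩ {ω | relRank ω (n + 1) = 1} ∩
      {ω | ∀ l ∈ Ioc (n + 1) N, 1 < relRank ω l} := by
    simp only [absRank_eq_one_iff (Nat.le_add_left 1 n) hn, Set.ofPred_and, Set.inter_assoc]
  have hcount := ((hA.mono n.le_succ).inter
    (isDetermined_relRank (· = 1))).ncard_inter_forall_lt_relRank hn le_rfl 1
  rw [hsplit]
  simpa only [Nat.descFactorial_one, hA.ncard_inter_relRank_eq hn (c := 1) (by simp)] using hcount

/-- The event that the best of all objects appears after moment `n` and that none of the objects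
appearing between moment `n` and the best one is among the `r` best seen up to its moment. -/
def lateBest (r n : ℕ) : Set (Equiv.Perm (Fin N)) :=
  {ω | ∃ m ∈ Ico n N, (∀ l ∈ Ioc n m, r < relRank ω l) ∧ absRank ω (m + 1) = 1}

theorem IsDetermined.ncard_inter_lateBest {r : ℕ} (hA : IsDetermined n A) (hr : r ≤ n) :
    (N : ℝ) * (A ∩ lateBest r n).ncard =
      A.ncard * ∑ m ∈ Ico n N, (n.descFactorial r : ℝ) / m.descFactorial r := by
  have hunion : A ∩ lateBest r n = ⋃ m ∈ Ico n N,
      A ∩ {ω | ∀ l ∈ Ioc n m, r < relRank ω l} ∩ {ω | absRank ω (m + 1) = 1} := by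
    ext ω
    simp only [lateBest, Set.mem_inter_iff, Set.mem_ofPred_eq, Set.mem_iUnion, exists_prop]
    grind
  have hdisjoint : (Ico n N : Set ℕ).PairwiseDisjoint fun m =>
      A ∩ {ω | ∀ l ∈ Ioc n m, r < relRank ω l} ∩ {ω | absRank ω (m + 1) = 1} := by
    refine fun i hi j hj hij => Set.disjoint_left.2 fun ω hω hω' => hij ?_
    rw [coe_Ico, Set.mem_Ico] at hi hj
    exact Nat.succ_injective ((absRank_bijOn ω).injOn ⟨by omega, hi.2⟩ ⟨by omega, hj.2⟩
      (hω.2.trans hω'.2.symm))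
  rw [hunion, ncard_biUnion_finset _ hdisjoint, Nat.cast_sum, mul_sum, mul_sum]
  refine sum_congr rfl fun m hm => ?_
  rw [mem_Ico] at hm
  have hforall := hA.ncard_inter_forall_lt_relRank hm.1 hm.2.le r
  have hbest := ((hA.mono hm.1).inter
    (isDetermined_forall_relRank (n := n) (r < ·))).ncard_inter_absRank_eq_one hm.2
  have hpos : (0 : ℝ) < m.descFactorial r :=
    Nat.cast_pos.2 (Nat.descFactorial_pos.2 (hr.trans hm.1))
  rw [mul_div_assoc', eq_div_iff hpos.ne']
  norm_cast
  rw [hbest, mul_comm, hforall, mul_comm]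

end IsDetermined

/-! ### Player 1's object and the ranks seen by Player 2 -/

theorem mu0_spec (h : mu0 ω ≤ N) : nStar N ≤ mu0 ω ∧ relRank ω (mu0 ω) = 1 := by
  have hmem : mu0 ω ∈ {n : ℕ | nStar N ≤ n ∧ n ≤ N ∧ relRank ω n = 1} ∪ {N + 1} :=
    Nat.sInf_mem ⟨N + 1, Or.inr rfl⟩
  rcases hmem with ⟨hstar, -, hrel⟩ | hlast
  · exact ⟨hstar, hrel⟩
  · rw [Set.mem_singleton_iff] at hlast
    omega

theorem mu0_le {n : ℕ} (hstar : nStar N ≤ n) (hN : n ≤ N) (hrel : relRank ω n = 1) : mu0 ω ≤ n :=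
  Nat.sInf_le (Or.inl ⟨hstar, hN, hrel⟩)

theorem one_le_mu0 (ω : Equiv.Perm (Fin N)) : 1 ≤ mu0 ω := by
  by_contra! h
  have hrel := (mu0_spec (ω := ω) (by omega)).2
  have := relRank_le ω (mu0 ω)
  omega

theorem Agree.mu0_eq {n : ℕ} (h : Agree n ω ω') (hN : n ≤ N) (hmu : mu0 ω ≤ n) :
    mu0 ω' = mu0 ω := by
  obtain ⟨hstar, hrel⟩ := mu0_spec (hmu.trans hN)
  have hle : mu0 ω' ≤ mu0 ω := mu0_le hstar (hmu.trans hN) (h _ hmu ▸ hrel)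
  obtain ⟨hstar', hrel'⟩ := mu0_spec (hle.trans (hmu.trans hN))
  exact hle.antisymm (mu0_le hstar' (hle.trans (hmu.trans hN)) (h _ (hle.trans hmu) ▸ hrel'))

theorem seenAt_of_lt {i : ℕ} (h : i < mu0 ω) : seenAt ω i = i := if_pos h

theorem seenAt_of_le {i : ℕ} (h : mu0 ω ≤ i) : seenAt ω i = i + 1 := if_neg h.not_gt

theorem le_seenAt (ω : Equiv.Perm (Fin N)) (i : ℕ) : i ≤ seenAt ω i := by
  unfold seenAt; split_ifs <;> omega

theorem seenAt_le_succ (ω : Equiv.Perm (Fin N)) (i : ℕ) : seenAt ω i ≤ i + 1 := by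
  unfold seenAt; split_ifs <;> omega

theorem seenAt_injective (ω : Equiv.Perm (Fin N)) : Function.Injective (seenAt ω) := by
  intro i j h
  unfold seenAt at h
  split_ifs at h <;> omega

theorem seenAt_ne_mu0 (ω : Equiv.Perm (Fin N)) (i : ℕ) : seenAt ω i ≠ mu0 ω := by
  unfold seenAt; split_ifs <;> omega

theorem insert_mu0_image_seenAt {m : ℕ} (h : mu0 ω ≤ m) :
    insert (mu0 ω) ((Icc 1 m).image (seenAt ω)) = Icc 1 (m + 1) := by
  refine eq_of_subset_of_card_le (insert_subset_iff.2 ⟨?_, image_subset_iff.2 fun i hi => ?_⟩) ?_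
  · exact mem_Icc.2 ⟨one_le_mu0 ω, by omega⟩
  · rw [mem_Icc] at hi ⊢
    exact ⟨hi.1.trans (le_seenAt ω i), (seenAt_le_succ ω i).trans (by omega)⟩
  · rw [card_insert_of_notMem fun hmem => ?_, card_image_of_injective _ (seenAt_injective ω)]
    · simp
    · obtain ⟨i, -, hi⟩ := mem_image.1 hmem
      exact seenAt_ne_mu0 ω i hi

theorem seenRank_of_lt {i : ℕ} (h : i < mu0 ω) : seenRank ω i = relRank ω i := by
  rw [seenRank, relRank, seenAt_of_lt h]
  refine congrArg card (filter_congr fun k hk => ?_)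
  rw [seenAt_of_lt ((mem_Icc.1 hk).2.trans_lt h)]

theorem seenRank_le (ω : Equiv.Perm (Fin N)) (n : ℕ) : seenRank ω n ≤ n :=
  (card_filter_le _ _).trans (by simp)

theorem one_le_seenRank {n : ℕ} (h1 : 1 ≤ n) : 1 ≤ seenRank ω n :=
  card_pos.2 ⟨n, by simp [h1]⟩

/-- The rank of the object taken by Player 1, which Player 2 does not see, among the first `n`
objects. -/
noncomputable def hiddenRank (ω : Equiv.Perm (Fin N)) (n : ℕ) : ℕ := rankAmong ω n (mu0 ω)

theorem one_le_hiddenRank {n : ℕ} (hmu : mu0 ω ≤ n) : 1 ≤ hiddenRank ω n :=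
  one_le_rankAmong (one_le_mu0 ω) hmu

theorem hiddenRank_succ {n : ℕ} (hmu : mu0 ω ≤ n) (hN : n < N) :
    hiddenRank ω (n + 1) =
      hiddenRank ω n + if relRank ω (n + 1) ≤ hiddenRank ω n then 1 else 0 :=
  rankAmong_succ (one_le_mu0 ω) hmu hN

theorem relRank_succ_eq_seenRank_add {m : ℕ} (hmu : mu0 ω ≤ m) (hN : m < N) :
    relRank ω (m + 1) =
      seenRank ω m + if hiddenRank ω m < relRank ω (m + 1) then 1 else 0 := by
  have hne : absRank ω (mu0 ω) ≠ absRank ω (m + 1) := fun h => by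
    have := (absRank_bijOn ω).injOn ⟨one_le_mu0 ω, by omega⟩ ⟨by omega, hN⟩ h
    omega
  have hiff : hiddenRank ω m < relRank ω (m + 1) ↔ absRank ω (mu0 ω) ≤ absRank ω (m + 1) := by
    rw [← not_le, hiddenRank, ← absRank_succ_le_iff (one_le_mu0 ω) hmu hN, not_le, hne.le_iff_lt]
  have hseen : #{i ∈ (Icc 1 m).image (seenAt ω) | absRank ω i ≤ absRank ω (m + 1)} =
      seenRank ω m := by
    rw [filter_image, card_image_of_injective _ (seenAt_injective ω), seenRank, seenAt_of_le hmu]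
  rw [if_congr hiff rfl rfl, relRank, ← insert_mu0_image_seenAt hmu, filter_insert, ← hseen]
  split_ifs
  · refine card_insert_of_notMem fun hmem => ?_
    obtain ⟨i, -, hi⟩ := mem_image.1 (mem_filter.1 hmem).1
    exact seenAt_ne_mu0 ω i hi
  · rfl

theorem seenRank_eq_iff {m : ℕ} (hmu : mu0 ω ≤ m) (hN : m < N) (r : ℕ) :
    seenRank ω m = r ↔ (relRank ω (m + 1) = r ∧ r ≤ hiddenRank ω m) ∨
      (relRank ω (m + 1) = r + 1 ∧ hiddenRank ω m ≤ r) := by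
  have h := relRank_succ_eq_seenRank_add hmu hN
  split_ifs at h <;> omega

theorem Agree.hiddenRank_eq {n : ℕ} (h : Agree n ω ω') (hN : n ≤ N) (hmu : mu0 ω ≤ n) :
    hiddenRank ω' n = hiddenRank ω n := by
  rw [hiddenRank, h.mu0_eq hN hmu, h.symm.rankAmong_eq hN (one_le_mu0 ω) hmu le_rfl, hiddenRank]

theorem Agree.seenRank_eq {n i : ℕ} (h : Agree n ω ω') (hN : n ≤ N) (hmu : mu0 ω ≤ n)
    (hin : i < n) : seenRank ω' i = seenRank ω i := by
  have hseenAt : seenAt ω' = seenAt ω := by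
    funext k
    rw [seenAt, seenAt, h.mu0_eq hN hmu]
  rw [seenRank, seenRank, hseenAt]
  refine congrArg card (filter_congr fun k hk => ?_)
  rw [mem_Icc] at hk
  have hmem {k : ℕ} (h1 : 1 ≤ k) (hki : k ≤ i) : 1 ≤ seenAt ω k ∧ seenAt ω k ≤ n :=
    ⟨h1.trans (le_seenAt ω k), (seenAt_le_succ ω k).trans (by omega)⟩
  have hk' := hmem hk.1 hk.2
  have hi' := hmem (hk.1.trans hk.2) le_rfl
  rw [← rankAmong_le_rankAmong_iff hk'.1 hk'.2, ← rankAmong_le_rankAmong_iff hk'.1 hk'.2,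
    h.rankAmong_eq hN hk'.1 hk'.2 le_rfl, h.rankAmong_eq hN hi'.1 hi'.2 le_rfl]

-- Let every object appearing after Player 1's be worse than hers, which shifts the ranks that
-- Player 2 sees by one.
theorem exists_seenRank_eq_and_hiddenRank_eq_one (hmu : mu0 ω ≤ N) :
    ∃ τ : Equiv.Perm (Fin N), mu0 τ = mu0 ω ∧ (∀ i ∈ Ico 1 N, seenRank τ i = seenRank ω i) ∧
      ∀ n ∈ Icc (mu0 ω) N, hiddenRank τ n = 1 := by
  obtain ⟨τ, hτ⟩ : ∃ τ : Equiv.Perm (Fin N), ∀ i ∈ Icc 1 N,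
      relRank τ i = if i ≤ mu0 ω then relRank ω i else seenRank ω (i - 1) + 1 := by
    refine exists_relRank_eq fun i hi => ?_
    rw [mem_Icc] at hi ⊢
    have := seenRank_le ω (i - 1)
    have := relRank_le ω i
    have := one_le_relRank (ω := ω) hi.1
    split_ifs <;> omega
  have hagree : Agree (mu0 ω) ω τ := fun i hi => by
    rcases Nat.eq_zero_or_pos i with rfl | hi0
    · simp [relRank]
    · rw [hτ i (mem_Icc.2 ⟨hi0, by omega⟩), if_pos hi]
  have hmuτ : mu0 τ = mu0 ω := hagree.mu0_eq hmu le_rfl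
  have hlater {l : ℕ} (hl : mu0 ω ≤ l) (hlN : l < N) : relRank τ (l + 1) = seenRank ω l + 1 := by
    rw [hτ _ (mem_Icc.2 (by omega)), if_neg (by omega), Nat.add_sub_cancel]
  have hhidden : ∀ n ∈ Icc (mu0 ω) N, hiddenRank τ n = 1 := fun n hn => by
    rw [mem_Icc] at hn
    rw [hiddenRank, rankAmong_eq_one_iff (one_le_mu0 τ) le_rfl (by omega) hn.2]
    refine ⟨(mu0_spec (by omega)).2, fun l hl => ?_⟩
    rw [hmuτ, mem_Ioc] at hl
    obtain ⟨l, rfl⟩ := Nat.exists_eq_add_of_le' (show 1 ≤ l by omega)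
    have := one_le_seenRank (ω := ω) (n := l) (by have := one_le_mu0 ω; omega)
    rw [hlater (by omega) (by omega)]
    omega
  refine ⟨τ, hmuτ, fun i hi => ?_, hhidden⟩
  rw [mem_Ico] at hi
  rcases lt_or_ge i (mu0 ω) with hlt | hge
  · rw [seenRank_of_lt (hmuτ ▸ hlt), seenRank_of_lt hlt, hagree i hlt.le]
  · rw [seenRank_eq_iff (hmuτ ▸ hge) hi.2, hhidden i (mem_Icc.2 ⟨hge, hi.2.le⟩)]
    exact Or.inr ⟨hlater hge hi.2, one_le_seenRank hi.1⟩

/-! ### Histories of Player 2 -/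

theorem length_hist (ω : Equiv.Perm (Fin N)) (j : ℕ) : (hist ω j).length = j := by
  simp [hist]

theorem hist_succ (ω : Equiv.Perm (Fin N)) (j : ℕ) :
    hist ω (j + 1) = hist ω j ++ [seenRank ω (j + 1)] := by
  simp [hist, List.range_succ]

theorem hist_prefix_hist (ω : Equiv.Perm (Fin N)) {j l : ℕ} (hjl : j ≤ l) :
    hist ω j <+: hist ω l := by
  induction l, hjl using Nat.le_induction with
  | base => exact List.prefix_rfl
  | succ l _ ih => exact hist_succ ω l ▸ ih.trans (List.prefix_append _ _)

theorem hist_congr {j : ℕ} (h : ∀ i ∈ Icc 1 j, seenRank ω' i = seenRank ω i) :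
    hist ω' j = hist ω j :=
  List.map_congr_left fun i hi => h _ (mem_Icc.2 ⟨by omega, List.mem_range.1 hi⟩)

theorem numSeen_le (ω : Equiv.Perm (Fin N)) : numSeen ω ≤ N := by
  unfold numSeen
  split_ifs <;> omega

theorem endsWithCandidate_hist {j : ℕ} (hj : 1 ≤ j) :
    EndsWithCandidate (hist ω j) ↔ seenRank ω j = 1 := by
  obtain ⟨j, rfl⟩ := Nat.exists_eq_add_of_le' hj
  simp [EndsWithCandidate, hist_succ]

theorem EndsWithCandidate.length_pos {h : List ℕ} (hd : EndsWithCandidate h) : 1 ≤ h.length := by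
  obtain ⟨g, rfl⟩ := List.getLast?_eq_some_iff.1 hd
  simp

theorem mem_event_concat {h : List ℕ} {r : ℕ} :
    ω ∈ event N (h ++ [r]) ↔
      ω ∈ event N h ∧ h.length < numSeen ω ∧ seenRank ω (h.length + 1) = r := by
  simp only [event, Set.mem_ofPred_eq, List.length_append, List.length_singleton, hist_succ]
  constructor
  · rintro ⟨hlen, hconcat⟩
    obtain ⟨hhist, hlast⟩ := List.append_inj' hconcat rfl
    exact ⟨⟨by omega, hhist⟩, hlen, by simpa using hlast⟩
  · rintro ⟨⟨-, hhist⟩, hlen, hlast⟩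
    exact ⟨hlen, by rw [hhist, hlast]⟩

theorem event_subset_event_of_prefix {h h' : List ℕ} (hp : h <+: h') :
    event N h' ⊆ event N h := by
  obtain ⟨t, rfl⟩ := hp
  induction t using List.reverseRecOn with
  | nil => rw [List.append_nil]
  | append_singleton t r ih =>
    rw [← List.append_assoc]
    exact fun ω hω => ih (mem_event_concat.1 hω).1

theorem seenRank_eq_one_of_mem_event {h : List ℕ} (hd : EndsWithCandidate h)
    (hω : ω ∈ event N h) : seenRank ω h.length = 1 := by
  rw [← hω.2] at hd
  exact (endsWithCandidate_hist (by simpa [hω.2] using hd.length_pos)).1 hd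

/-- Whenever the history `h` has been observed, Player 1 has taken her object before the last
object of `h` appeared. -/
def AfterPick (N : ℕ) (h : List ℕ) : Prop :=
  ∀ ω ∈ event N h, mu0 ω ≤ h.length

section AfterPick

variable {h h' : List ℕ}

/-- Before Player 1 has taken an object, both players see the same ranks, and from moment `n*` on
she takes the first candidate. -/
theorem EndsWithCandidate.afterPick (hd : EndsWithCandidate h) (hl : nStar N ≤ h.length) :
    AfterPick N h := by
  intro ω hω
  have hseen := seenRank_eq_one_of_mem_event hd hω
  by_contra! hlt
  rw [seenRank_of_lt hlt] at hseen
  exact hlt.not_ge (mu0_le hl (hω.1.trans (numSeen_le ω)) hseen)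

theorem AfterPick.of_prefix (hh : AfterPick N h) (hp : h <+: h') : AfterPick N h' :=
  fun ω hω => (hh ω (event_subset_event_of_prefix hp hω)).trans hp.length_le

theorem AfterPick.numSeen_eq (hh : AfterPick N h) (hω : ω ∈ event N h) : numSeen ω = N - 1 :=
  if_pos ((hh ω hω).trans (hω.1.trans (numSeen_le ω)))

theorem AfterPick.length_lt (hh : AfterPick N h) (hω : ω ∈ event N h) : h.length < N := by
  have hnum := hh.numSeen_eq hω
  have hlen := hω.1
  have hmu := (one_le_mu0 ω).trans (hh ω hω)
  omega

theorem AfterPick.isDetermined_event (hh : AfterPick N h) :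
    IsDetermined (h.length + 1) (event N h) := by
  intro ω ω' ha hω
  have hN := hh.length_lt hω
  have hmu := (hh ω hω).trans h.length.le_succ
  refine ⟨?_, (hist_congr fun i hi => ?_).trans hω.2⟩
  · rw [numSeen, ha.mu0_eq hN hmu, ← numSeen]
    exact hω.1
  · exact ha.seenRank_eq hN hmu (Nat.lt_succ_of_le (mem_Icc.1 hi).2)

theorem AfterPick.isDetermined_inter_hiddenRank (hh : AfterPick N h) (P : ℕ → Prop) :
    IsDetermined (h.length + 1) (event N h ∩ {ω | P (hiddenRank ω (h.length + 1))}) := by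
  rintro ω ω' ha ⟨hω, hP⟩
  refine ⟨hh.isDetermined_event ha hω, ?_⟩
  rwa [Set.mem_ofPred_eq,
    ha.hiddenRank_eq (hh.length_lt hω) ((hh ω hω).trans h.length.le_succ)]

theorem AfterPick.event_concat (hh : AfterPick N h) (hN : h.length + 1 < N) (r : ℕ) :
    event N (h ++ [r]) = event N h ∩ {ω | seenRank ω (h.length + 1) = r} := by
  ext ω
  rw [mem_event_concat]
  refine and_congr_right fun hω => and_iff_right ?_
  have := hh.numSeen_eq hω
  omega

theorem AfterPick.ncard_event_concat (hh : AfterPick N h) (hN : h.length + 1 < N) {r : ℕ}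
    (hr : r ∈ Icc 1 (h.length + 1)) :
    (h.length + 2) * (event N (h ++ [r])).ncard =
      (event N h).ncard + (event N h ∩ {ω | hiddenRank ω (h.length + 1) = r}).ncard := by
  set n := h.length + 1
  have hsplit : event N (h ++ [r]) =
      event N h ∩ {ω | r ≤ hiddenRank ω n} ∩ {ω | relRank ω (n + 1) = r} ∪
      event N h ∩ {ω | hiddenRank ω n ≤ r} ∩ {ω | relRank ω (n + 1) = r + 1} := by
    rw [hh.event_concat hN]
    ext ω
    have hseen (hω : ω ∈ event N h) := seenRank_eq_iff ((hh ω hω).trans h.length.le_succ) hN r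
    simp only [Set.mem_inter_iff, Set.mem_union, Set.mem_ofPred_eq]
    grind
  have hdisjoint : Disjoint
      (event N h ∩ {ω | r ≤ hiddenRank ω n} ∩ {ω | relRank ω (n + 1) = r})
      (event N h ∩ {ω | hiddenRank ω n ≤ r} ∩ {ω | relRank ω (n + 1) = r + 1}) :=
    Set.disjoint_left.2 fun ω hω hω' => r.succ_ne_self (hω'.2.symm.trans hω.2)
  have hunion : event N h ∩ {ω | r ≤ hiddenRank ω n} ∪ event N h ∩ {ω | hiddenRank ω n ≤ r} =
      event N h := by
    rw [← Set.inter_union_distrib_left]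
    exact Set.inter_eq_left.2 fun ω _ => le_total r _
  have hinter : event N h ∩ {ω | r ≤ hiddenRank ω n} ∩ (event N h ∩ {ω | hiddenRank ω n ≤ r}) =
      event N h ∩ {ω | hiddenRank ω n = r} := by
    ext ω
    simp only [Set.mem_inter_iff, Set.mem_ofPred_eq]
    grind
  have hcount (P : ℕ → Prop) {c : ℕ} (hc : 1 ≤ c) (hcn : c ≤ n + 1) : (h.length + 2) *
      (event N h ∩ {ω | P (hiddenRank ω n)} ∩ {ω | relRank ω (n + 1) = c}).ncard =
        (event N h ∩ {ω | P (hiddenRank ω n)}).ncard :=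
    (hh.isDetermined_inter_hiddenRank P).ncard_inter_relRank_eq hN (mem_Icc.2 ⟨hc, hcn⟩)
  rw [mem_Icc] at hr
  rw [hsplit, Set.ncard_union_eq hdisjoint, mul_add, hcount (r ≤ ·) hr.1 (by omega),
    hcount (· ≤ r) (by omega) (by omega), ← Set.ncard_union_add_ncard_inter, hunion, hinter]

theorem AfterPick.ncard_event_concat_inter_hiddenRank (hh : AfterPick N h)
    (hN : h.length + 1 < N) {r : ℕ} (hr : r ∈ Icc 1 (h.length + 1)) :
    (h.length + 2) * (event N (h ++ [r]) ∩ {ω | hiddenRank ω (h.length + 2) = 1}).ncard =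
      (event N h ∩ {ω | hiddenRank ω (h.length + 1) = 1}).ncard := by
  rw [mem_Icc] at hr
  have heq : event N (h ++ [r]) ∩ {ω | hiddenRank ω (h.length + 2) = 1} =
      event N h ∩ {ω | hiddenRank ω (h.length + 1) = 1} ∩
        {ω | relRank ω (h.length + 1 + 1) = r + 1} := by
    rw [hh.event_concat hN]
    ext ω
    simp only [Set.mem_inter_iff, Set.mem_ofPred_eq, and_assoc]
    refine and_congr_right fun hω => ?_
    have hmu : mu0 ω ≤ h.length + 1 := (hh ω hω).trans (Nat.le_succ _)
    have hpos := one_le_hiddenRank hmu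
    rw [seenRank_eq_iff hmu hN, hiddenRank_succ hmu hN]
    split_ifs <;> omega
  rw [heq]
  exact (hh.isDetermined_inter_hiddenRank (· = 1)).ncard_inter_relRank_eq hN
    (mem_Icc.2 (by omega))

theorem AfterPick.nonempty_event_inter_hiddenRank (hh : AfterPick N h)
    (hne : (event N h).Nonempty) :
    (event N h ∩ {ω | hiddenRank ω (h.length + 1) = 1}).Nonempty := by
  obtain ⟨ω, hω⟩ := hne
  have hN := hh.length_lt hω
  have hmu := hh ω hω
  obtain ⟨τ, hmuτ, hseen, hhidden⟩ := exists_seenRank_eq_and_hiddenRank_eq_one (hmu.trans hN.le)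
  refine ⟨τ, ⟨?_, (hist_congr fun i hi => ?_).trans hω.2⟩,
    hhidden _ (mem_Icc.2 ⟨by omega, hN⟩)⟩
  · rw [numSeen, hmuτ, ← numSeen]
    exact hω.1
  · rw [mem_Icc] at hi
    exact hseen i (mem_Ico.2 ⟨hi.1, by omega⟩)

end AfterPick

/-! ### The posterior probability that Player 1's object is the best so far -/

section CondProb

variable {E E' F : Set (Equiv.Perm (Fin N))}

theorem condProb_nonneg (E F : Set (Equiv.Perm (Fin N))) : 0 ≤ condProb E F := by
  unfold condProb
  positivity

theorem condProb_congr (h : ∀ ω ∈ F, ω ∈ E ↔ ω ∈ E') : condProb E F = condProb E' F := by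
  unfold condProb
  congr 3
  ext ω
  exact and_congr_left fun hω => h ω hω

theorem condProb_inter_add_condProb_compl_inter (E F G : Set (Equiv.Perm (Fin N))) :
    condProb (G ∩ E) F + condProb (Gᶜ ∩ E) F = condProb E F := by
  rw [condProb, condProb, ← add_div, Set.inter_assoc, Set.inter_assoc, Set.inter_comm G,
    Set.inter_comm Gᶜ, ← Set.sdiff_eq, ← Nat.cast_add,
    Set.ncard_inter_add_ncard_sdiff_eq_ncard _ _ (Set.toFinite _), condProb]

theorem condProb_compl (hF : F.Nonempty) : condProb Eᶜ F = 1 - condProb E F := by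
  have hpos : (F.ncard : ℝ) ≠ 0 := by
    exact_mod_cast ((Set.ncard_pos F.toFinite).2 hF).ne'
  have hadd := condProb_inter_add_condProb_compl_inter Set.univ F E
  rw [Set.inter_univ, Set.inter_univ, condProb.eq_1 Set.univ, Set.univ_inter, div_self hpos] at hadd
  linarith

end CondProb

/-- The conditional probability, given the history `h` of Player 2, that the object taken by
Player 1 is the best among the first `h.length + 1` objects; these are all the objects that have
appeared if Player 1 has already taken hers (`AfterPick`). -/
noncomputable def hiddenBestProb (N : ℕ) (h : List ℕ) : ℝ :=
  condProb {ω | hiddenRank ω (h.length + 1) = 1} (event N h)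

section HiddenBestProb

variable {h h' : List ℕ}

theorem AfterPick.hiddenBestProb_pos (hh : AfterPick N h) (hne : (event N h).Nonempty) :
    0 < hiddenBestProb N h := by
  have hbest := (Set.ncard_pos (Set.toFinite _)).2 (hh.nonempty_event_inter_hiddenRank hne)
  have hevent := (Set.ncard_pos (Set.toFinite _)).2 hne
  rw [hiddenBestProb, condProb, Set.inter_comm]
  positivity

theorem AfterPick.hiddenBestProb_concat (hh : AfterPick N h) {r : ℕ}
    (hne : (event N (h ++ [r])).Nonempty) :
    hiddenBestProb N (h ++ [r]) = hiddenBestProb N h /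
      (1 + condProb {ω | hiddenRank ω (h.length + 1) = r} (event N h)) := by
  obtain ⟨ω, hω⟩ := id hne
  obtain ⟨hωh, hseen, hrank⟩ := mem_event_concat.1 hω
  have hN : h.length + 1 < N := by
    have := hh.numSeen_eq hωh
    omega
  have hr : r ∈ Icc 1 (h.length + 1) :=
    hrank ▸ mem_Icc.2 ⟨one_le_seenRank (Nat.succ_pos _), seenRank_le ω _⟩
  have hevent := congrArg (Nat.cast (R := ℝ)) (hh.ncard_event_concat hN hr)
  have hbest := congrArg (Nat.cast (R := ℝ)) (hh.ncard_event_concat_inter_hiddenRank hN hr)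
  have hpos : (0 : ℝ) < (event N h).ncard := by
    exact_mod_cast (Set.ncard_pos (Set.toFinite _)).2 ⟨ω, hωh⟩
  have hpos' : (0 : ℝ) < (event N (h ++ [r])).ncard := by
    exact_mod_cast (Set.ncard_pos (Set.toFinite _)).2 hne
  simp only [hiddenBestProb, condProb, List.length_append, List.length_singleton,
    Set.inter_comm _ (event N _)]
  push_cast at hevent hbest
  rw [← hbest, one_add_div hpos.ne', ← hevent]
  field_simp

theorem AfterPick.hiddenBestProb_le_of_prefix (hh : AfterPick N h) (hp : h <+: h')
    (hne : (event N h').Nonempty) : hiddenBestProb N h' ≤ hiddenBestProb N h := by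
  obtain ⟨t, rfl⟩ := hp
  induction t using List.reverseRecOn with
  | nil => rw [List.append_nil]
  | append_singleton t r ih =>
    rw [← List.append_assoc] at hne ⊢
    have hg := hh.of_prefix (List.prefix_append h t)
    rw [hg.hiddenBestProb_concat hne]
    refine (div_le_self (condProb_nonneg _ _) ?_).trans
      (ih (hne.mono (event_subset_event_of_prefix (List.prefix_append _ _))))
    exact le_add_of_nonneg_right (condProb_nonneg _ _)

theorem IsDecisionPoint.p_eq (hd : IsDecisionPoint N h) (hl : nStar N ≤ h.length) :
    p N h = 1 - hiddenBestProb N h := by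
  rw [hiddenBestProb, ← condProb_compl hd.1]
  refine condProb_congr fun ω hω => ?_
  have hh := hd.2.afterPick hl
  have hmu := hh ω hω
  have hN := hh.length_lt hω
  have hpos := one_le_hiddenRank hmu
  have hrank := (seenRank_eq_iff hmu hN 1).1 (seenRank_eq_one_of_mem_event hd.2 hω)
  simp only [Set.mem_ofPred_eq, Set.mem_compl_iff, seenAt_of_le hmu]
  rw [hiddenRank_succ hmu hN]
  split_ifs <;> omega

theorem IsDecisionPoint.p_lt (hd : IsDecisionPoint N h) (hl : nStar N ≤ h.length)
    (hd' : IsDecisionPoint N h') (hp : h <+: h') (hne : h ≠ h') : p N h < p N h' := by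
  rw [hd.p_eq hl, hd'.p_eq (hl.trans hp.length_le)]
  refine sub_lt_sub_left ?_ _
  obtain ⟨g, rfl⟩ := List.getLast?_eq_some_iff.1 hd'.2
  have hpg : h <+: g := (List.prefix_concat_iff.1 hp).resolve_left hne
  have hg := (hd.2.afterPick hl).of_prefix hpg
  have hgne := hd'.1.mono (event_subset_event_of_prefix (List.prefix_append g [1]))
  have hpos := hg.hiddenBestProb_pos hgne
  calc hiddenBestProb N (g ++ [1])
      = hiddenBestProb N g / (1 + hiddenBestProb N g) := hg.hiddenBestProb_concat hd'.1
    _ < hiddenBestProb N g := div_lt_self hpos (lt_add_of_pos_right 1 hpos)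
    _ ≤ hiddenBestProb N h := (hd.2.afterPick hl).hiddenBestProb_le_of_prefix hpg hgne

end HiddenBestProb

/-! ### The thresholds -/

theorem u_of_le {n : ℕ} (h : N ≤ n) : u N n = 0 := by
  rw [u, if_neg h.not_gt]

theorem u_of_lt {n : ℕ} (h : n < N) : u N n =
    1 / ((n : ℝ) + 1) * max (((n : ℝ) + 1) / N) (u N (n + 1))
      + (n : ℝ) / ((n : ℝ) + 1) * u N (n + 1) := by
  rw [u, if_pos h]

theorem u_antitone (N : ℕ) : Antitone (u N) := by
  refine antitone_nat_of_succ_le fun n => ?_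
  rcases lt_or_ge n N with h | h
  · calc u N (n + 1) = 1 / ((n : ℝ) + 1) * u N (n + 1) + n / ((n : ℝ) + 1) * u N (n + 1) := by
          field_simp
          ring
      _ ≤ 1 / ((n : ℝ) + 1) * max (((n : ℝ) + 1) / N) (u N (n + 1))
            + n / ((n : ℝ) + 1) * u N (n + 1) := by
          gcongr
          exact le_max_right _ _
      _ = u N n := (u_of_lt h).symm
  · rw [u_of_le h, u_of_le (h.trans n.le_succ)]

theorem u_nStar_le (N : ℕ) : u N (nStar N) ≤ (nStar N : ℝ) / N :=
  Nat.sInf_mem (s := {n : ℕ | u N n ≤ (n : ℝ) / N})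
    ⟨N, by simpa [u_of_le le_rfl] using by positivity⟩

theorem nStar_le (N : ℕ) : nStar N ≤ N :=
  Nat.sInf_le (by simpa [u_of_le le_rfl] using by positivity)

theorem one_le_nStar (hN : 1 ≤ N) : 1 ≤ nStar N := by
  by_contra! hzero
  have hle := u_nStar_le N
  have hmax := le_max_left ((1 : ℝ) / N) (u N 1)
  have hpos : (0 : ℝ) < 1 / N := by positivity
  simp only [Nat.lt_one_iff.1 hzero, u_of_lt hN, CharP.cast_eq_zero, zero_add, div_one, one_mul,
    zero_div, zero_mul, add_zero] at hle
  linarith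

theorem S1_eq_sum_Ico (N n : ℕ) : S1 N n = ∑ m ∈ Ico n N, 1 / (m : ℝ) := by
  rw [S1, ← Ico_add_one_right_eq_Icc, ← sum_Ico_add']
  simp

theorem S2_eq_sum_Ico (N n : ℕ) :
    S2 N n = ∑ m ∈ Ico n N, ((n : ℝ) - 1) / ((m : ℝ) * ((m : ℝ) - 1)) := by
  rw [S2, ← Ico_add_one_right_eq_Icc, ← sum_Ico_add']
  refine sum_congr rfl fun m _ => ?_
  push_cast
  ring_nf

theorem mul_S1_eq (N n : ℕ) :
    n * S1 N n = ∑ m ∈ Ico n N, (n.descFactorial 1 : ℝ) / m.descFactorial 1 := by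
  simp only [S1_eq_sum_Ico, mul_sum, Nat.descFactorial_one, mul_one_div]

theorem mul_S2_eq (N n : ℕ) :
    n * S2 N n = ∑ m ∈ Ico n N, (n.descFactorial 2 : ℝ) / m.descFactorial 2 := by
  simp only [S2_eq_sum_Ico, mul_sum, Nat.cast_descFactorial_two, mul_div_assoc]

theorem u_eq_S1 (hN : 1 ≤ N) {n : ℕ} (hstar : nStar N ≤ n) (hn : n ≤ N) :
    u N n = n / N * S1 N n := by
  have hpos := one_le_nStar hN
  induction hn using Nat.decreasingInduction with
  | self => simp [u_of_le le_rfl, S1_eq_sum_Ico]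
  | of_succ n hn ih =>
    have hn0 : (0 : ℝ) < n := by exact_mod_cast hpos.trans hstar
    have hmax : u N (n + 1) ≤ ((n : ℝ) + 1) / N :=
      calc u N (n + 1) ≤ u N (nStar N) := u_antitone N (hstar.trans n.le_succ)
        _ ≤ nStar N / N := u_nStar_le N
        _ ≤ (n + 1) / N := by gcongr; exact_mod_cast hstar.trans n.le_succ
    rw [u_of_lt hn, max_eq_left hmax, ih (hstar.trans n.le_succ), S1_eq_sum_Ico N n,
      sum_eq_sum_Ico_succ_bot hn, ← S1_eq_sum_Ico]
    push_cast
    field_simp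

theorem S1_nStar_le_one (hN : 1 ≤ N) : S1 N (nStar N) ≤ 1 := by
  have hpos : (0 : ℝ) < nStar N := by exact_mod_cast one_le_nStar hN
  have hle := u_nStar_le N
  rw [u_eq_S1 hN le_rfl (nStar_le N)] at hle
  exact (mul_le_iff_le_one_right (by positivity)).1 hle

theorem S1_strictAntiOn (N : ℕ) : StrictAntiOn (S1 N) (Set.Icc 1 N) := by
  intro n hn n' hn' hlt
  have hpos : (0 : ℝ) < n := by exact_mod_cast hn.1
  rw [S1_eq_sum_Ico, S1_eq_sum_Ico]
  exact sum_lt_sum_of_subset (Ico_subset_Ico_left hlt.le)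
    (left_mem_Ico.2 (hlt.trans_le hn'.2)) (by simp [hlt]) (by positivity)
    fun m _ _ => by positivity

theorem S1_lt_one {n : ℕ} (hn : nStar N < n) (hnN : n ≤ N) : S1 N n < 1 := by
  have hpos := one_le_nStar (show 1 ≤ N by omega)
  exact (S1_strictAntiOn N ⟨hpos, nStar_le N⟩ ⟨by omega, hnN⟩ hn).trans_le
    (S1_nStar_le_one (by omega))

theorem S2_eq {n : ℕ} (hn : 2 ≤ n) (hnN : n ≤ N) : S2 N n = ((N : ℝ) - n) / (N - 1) := by
  rw [S2_eq_sum_Ico]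
  induction N, hnN using Nat.le_induction with
  | base => simp
  | succ N hnN ih =>
    have hN : (2 : ℝ) ≤ N := by exact_mod_cast hn.trans hnN
    have hN1 : (N : ℝ) - 1 ≠ 0 := by linarith
    rw [sum_Ico_succ_top hnN, ih]
    push_cast
    rw [add_sub_cancel_right]
    field_simp
    ring

theorem S2_nonneg {n : ℕ} (hn : 2 ≤ n) (hnN : n ≤ N) : 0 ≤ S2 N n := by
  have hn' : (2 : ℝ) ≤ n := by exact_mod_cast hn
  have hnN' : (n : ℝ) ≤ N := by exact_mod_cast hnN
  rw [S2_eq hn hnN]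
  exact div_nonneg (by linarith) (by linarith)

theorem S2_strictAntiOn (N : ℕ) : StrictAntiOn (S2 N) (Set.Icc 2 N) := by
  intro n hn n' hn' hlt
  have hN : (2 : ℝ) ≤ N := by exact_mod_cast hn.1.trans hn.2
  rw [S2_eq hn.1 hn.2, S2_eq hn'.1 hn'.2]
  gcongr
  linarith

theorem q_strictAntiOn (N : ℕ) : StrictAntiOn (q N) (Set.Ioc (nStar N) N) := by
  rintro n ⟨hn, hnN⟩ n' ⟨hn', hnN'⟩ hlt
  have hpos := one_le_nStar (show 1 ≤ N by omega)
  have hone : 0 < 1 - S1 N n := sub_pos.2 (S1_lt_one hn hnN)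
  have hS2' : 0 ≤ S2 N n' := S2_nonneg (by omega) hnN'
  have hS1lt : S1 N n' < S1 N n := S1_strictAntiOn N ⟨by omega, hnN⟩ ⟨by omega, hnN'⟩ hlt
  have hS2lt : S2 N n' < S2 N n := S2_strictAntiOn N ⟨by omega, hnN⟩ ⟨by omega, hnN'⟩ hlt
  have hcross : S2 N n' * (1 - S1 N n) < S2 N n * (1 - S1 N n') :=
    mul_lt_mul'' hS2lt (by linarith) hS2' hone.le
  rw [q, q, div_lt_div_iff₀ (by linarith) (by linarith)]
  linarith

theorem q_le_iff {n : ℕ} (hn : nStar N < n) (hnN : n ≤ N) (x : ℝ) :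
    q N n ≤ x ↔ x * S1 N n + (1 - x) * S2 N n ≤ x := by
  have hpos := one_le_nStar (show 1 ≤ N by omega)
  have hS1 := S1_lt_one hn hnN
  have hS2 : 0 ≤ S2 N n := S2_nonneg (by omega) hnN
  rw [q, div_le_iff₀ (by linarith)]
  constructor <;> intro h <;> linarith

/-! ### The rewards from accepting now and from accepting the next candidate -/

theorem seenRank_eq_one_of_absRank {j : ℕ} (hj : 1 ≤ j) (hjN : j ≤ numSeen ω)
    (hbest : absRank ω (seenAt ω j) = 1) : seenRank ω j = 1 := by
  have hnum := numSeen_le ω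
  rcases lt_or_ge j (mu0 ω) with hlt | hge
  · rw [seenAt_of_lt hlt, absRank_eq_one_iff hj (hjN.trans hnum)] at hbest
    rw [seenRank_of_lt hlt, hbest.1]
  · have hN : j < N := by
      rw [numSeen, if_pos (hge.trans (hjN.trans hnum))] at hjN
      omega
    rw [seenAt_of_le hge, absRank_eq_one_iff (by omega) hN] at hbest
    exact (seenRank_eq_iff hge hN 1).2 (Or.inl ⟨hbest.1, one_le_hiddenRank hge⟩)

theorem winsFrom_candidate_iff {n : ℕ} (hmu : mu0 ω ≤ n) (hn : n ≤ N) :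
    WinsFrom {g | EndsWithCandidate g} n ω ↔
      ∃ m ∈ Ico n N, (∀ l ∈ Ico n m, seenRank ω l ≠ 1) ∧ absRank ω (m + 1) = 1 := by
  have hpos := one_le_mu0 ω
  have hnum : numSeen ω = N - 1 := if_pos (hmu.trans hn)
  have hcand (l : ℕ) (hl : n ≤ l) :
      hist ω l ∈ {g | EndsWithCandidate g} ↔ seenRank ω l = 1 :=
    endsWithCandidate_hist (by omega)
  constructor
  · rintro ⟨m, hnm, hm, -, hlater, hbest⟩
    rw [seenAt_of_le (hmu.trans hnm)] at hbest
    refine ⟨m, mem_Ico.2 (by omega), fun l hl => ?_, hbest⟩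
    rw [mem_Ico] at hl
    exact (hcand l hl.1).not.1 (hlater l hl.1 hl.2)
  · rintro ⟨m, hm, hlater, hbest⟩
    rw [mem_Ico] at hm
    rw [← seenAt_of_le (hmu.trans hm.1)] at hbest
    have hmN : m ≤ numSeen ω := by omega
    exact ⟨m, hm.1, hmN,
      (hcand m hm.1).2 (seenRank_eq_one_of_absRank (by omega) hmN hbest),
      fun l hl hlm => (hcand l hl).not.2 (hlater l (mem_Ico.2 ⟨hl, hlm⟩)), hbest⟩

theorem seenRank_ne_one_iff {m : ℕ} (hmu : mu0 ω ≤ m) (hN : m < N) :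
    seenRank ω m ≠ 1 ↔ (if hiddenRank ω m = 1 then 2 else 1) < relRank ω (m + 1) := by
  have hpos := one_le_hiddenRank hmu
  have hrel := one_le_relRank (ω := ω) (n := m + 1) (by omega)
  rw [Ne, seenRank_eq_iff hmu hN]
  split_ifs <;> omega

theorem hiddenRank_eq_one_iff_of_forall_seenRank_ne_one {n m : ℕ} (hmu : mu0 ω ≤ n)
    (hnm : n ≤ m) (hm : m ≤ N) (hseen : ∀ l ∈ Ico n m, seenRank ω l ≠ 1) :
    hiddenRank ω m = 1 ↔ hiddenRank ω n = 1 := by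
  induction m, hnm using Nat.le_induction with
  | base => rfl
  | succ m hnm ih =>
    rw [← insert_Ico_right_eq_Ico_add_one hnm, forall_mem_insert] at hseen
    have hmum := hmu.trans hnm
    have hpos := one_le_hiddenRank hmum
    have hlast := (seenRank_ne_one_iff hmum hm).1 hseen.1
    rw [← ih (by omega) hseen.2, hiddenRank_succ hmum hm]
    split_ifs at hlast ⊢ <;> omega

theorem forall_seenRank_ne_one_iff {n m : ℕ} (hmu : mu0 ω ≤ n) (hnm : n ≤ m) (hm : m ≤ N) :
    (∀ l ∈ Ico n m, seenRank ω l ≠ 1) ↔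
      ∀ l ∈ Ioc n m, (if hiddenRank ω n = 1 then 2 else 1) < relRank ω l := by
  induction m, hnm using Nat.le_induction with
  | base => simp
  | succ m hnm ih =>
    rw [← insert_Ico_right_eq_Ico_add_one hnm, ← insert_Ioc_right_eq_Ioc_add_one hnm,
      forall_mem_insert, forall_mem_insert, ← ih (by omega)]
    refine and_congr_left fun hseen => ?_
    rw [seenRank_ne_one_iff (hmu.trans hnm) hm, if_congr
      (hiddenRank_eq_one_iff_of_forall_seenRank_ne_one hmu hnm (by omega) hseen) rfl rfl]

theorem winsFrom_candidate_iff_mem_lateBest {n : ℕ} (hmu : mu0 ω ≤ n) (hn : n ≤ N) :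
    WinsFrom {g | EndsWithCandidate g} n ω ↔
      ω ∈ lateBest (if hiddenRank ω n = 1 then 2 else 1) n := by
  rw [winsFrom_candidate_iff hmu hn]
  refine exists_congr fun m => and_congr_right fun hm => and_congr_left fun _ => ?_
  rw [mem_Ico] at hm
  exact forall_seenRank_ne_one_iff hmu hm.1 hm.2.le

section IsDetermined

variable {E F : Set (Equiv.Perm (Fin N))} {n : ℕ}

theorem IsDetermined.condProb_inter_forall_lt_relRank (hA : IsDetermined n (F ∩ E)) {m : ℕ}
    (hnm : n ≤ m) (hN : m ≤ N) (r : ℕ) :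
    m.descFactorial r * condProb (E ∩ {ω | ∀ l ∈ Ioc n m, r < relRank ω l}) F =
      n.descFactorial r * condProb E F := by
  rw [condProb, condProb, Set.inter_comm, ← Set.inter_assoc, Set.inter_comm E, ← mul_div_assoc,
    ← mul_div_assoc]
  exact_mod_cast congrArg (fun k : ℕ => (k : ℝ) / F.ncard)
    (hA.ncard_inter_forall_lt_relRank hnm hN r)

theorem IsDetermined.condProb_inter_lateBest (hA : IsDetermined n (F ∩ E)) {r : ℕ} (hr : r ≤ n) :
    N * condProb (E ∩ lateBest r n) F =
      condProb E F * ∑ m ∈ Ico n N, (n.descFactorial r : ℝ) / m.descFactorial r := by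
  rw [condProb, condProb, Set.inter_comm, ← Set.inter_assoc, Set.inter_comm E, ← mul_div_assoc,
    hA.ncard_inter_lateBest hr]
  ring

end IsDetermined

section DecisionPoint

variable {h h' : List ℕ}

theorem IsDecisionPoint.length_lt (hd : IsDecisionPoint N h) (hl : nStar N ≤ h.length) :
    h.length < N :=
  (hd.2.afterPick hl).length_lt hd.1.some_mem

theorem IsDecisionPoint.stopReward_eq (hd : IsDecisionPoint N h) (hl : nStar N ≤ h.length) :
    stopReward N h = ((h.length + 1 : ℕ) : ℝ) / N * p N h := by
  have hh := hd.2.afterPick hl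
  have hN := hd.length_lt hl
  have hN0 : (0 : ℝ) < N := by exact_mod_cast hN.pos
  have hp : p N h = condProb {ω | relRank ω (h.length + 1) = 1} (event N h) :=
    condProb_congr fun ω hω => by
      rw [Set.mem_ofPred_eq, Set.mem_ofPred_eq, seenAt_of_le (hh ω hω)]
  have hbest : stopReward N h = condProb ({ω | relRank ω (h.length + 1) = 1} ∩
      {ω | ∀ l ∈ Ioc (h.length + 1) N, 1 < relRank ω l}) (event N h) :=
    condProb_congr fun ω hω => by
      rw [Set.mem_ofPred_eq, seenAt_of_le (hh ω hω), absRank_eq_one_iff (Nat.succ_pos _) hN]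
      rfl
  have hcount := (hh.isDetermined_event.inter
    (isDetermined_relRank (· = 1))).condProb_inter_forall_lt_relRank hN le_rfl 1
  rw [← hbest, ← hp, Nat.descFactorial_one, Nat.descFactorial_one] at hcount
  rw [div_mul_eq_mul_div, eq_div_iff hN0.ne', mul_comm, hcount]

theorem AfterPick.nextReward_eq_add (hh : AfterPick N h) : nextReward N h =
    condProb ({ω | hiddenRank ω (h.length + 1) = 1} ∩ lateBest 2 (h.length + 1)) (event N h) +
    condProb ({ω | hiddenRank ω (h.length + 1) = 1}ᶜ ∩ lateBest 1 (h.length + 1))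
      (event N h) := by
  have hwins (ω) (hω : ω ∈ event N h) := winsFrom_candidate_iff_mem_lateBest
    (n := h.length + 1) ((hh ω hω).trans h.length.le_succ) (hh.length_lt hω)
  rw [nextReward, value,
    ← condProb_inter_add_condProb_compl_inter _ _ {ω | hiddenRank ω (h.length + 1) = 1}]
  congr 1
  · refine condProb_congr fun ω hω => and_congr_right fun hr => ?_
    rw [Set.mem_ofPred_eq, hwins ω hω, if_pos (show hiddenRank ω _ = 1 from hr)]
  · refine condProb_congr fun ω hω => and_congr_right fun hr => ?_
    rw [Set.mem_ofPred_eq, hwins ω hω, if_neg (show ¬hiddenRank ω _ = 1 from hr)]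

theorem IsDecisionPoint.nextReward_eq (hd : IsDecisionPoint N h) (hl : nStar N ≤ h.length) :
    nextReward N h = ((h.length + 1 : ℕ) : ℝ) / N *
      (p N h * S1 N (h.length + 1) + (1 - p N h) * S2 N (h.length + 1)) := by
  have hh := hd.2.afterPick hl
  have hN0 : (0 : ℝ) < N := by exact_mod_cast (hd.length_lt hl).pos
  have hbest : N * condProb ({ω | hiddenRank ω (h.length + 1) = 1} ∩ lateBest 2 (h.length + 1))
      (event N h) = (1 - p N h) * ((h.length + 1 : ℕ) * S2 N (h.length + 1)) := by
    rw [(hh.isDetermined_inter_hiddenRank (· = 1)).condProb_inter_lateBest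
      (Nat.succ_le_succ hd.2.length_pos), ← hiddenBestProb, hd.p_eq hl, sub_sub_cancel, mul_S2_eq]
  have hdet : IsDetermined (h.length + 1)
      (event N h ∩ {ω | hiddenRank ω (h.length + 1) = 1}ᶜ) :=
    hh.isDetermined_inter_hiddenRank (¬ · = 1)
  have hother : N * condProb ({ω | hiddenRank ω (h.length + 1) = 1}ᶜ ∩
      lateBest 1 (h.length + 1)) (event N h) =
        p N h * ((h.length + 1 : ℕ) * S1 N (h.length + 1)) := by
    rw [hdet.condProb_inter_lateBest (Nat.succ_pos _), condProb_compl hd.1, ← hiddenBestProb,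
      hd.p_eq hl, mul_S1_eq]
  rw [hh.nextReward_eq_add, div_mul_eq_mul_div, eq_div_iff hN0.ne']
  linear_combination hbest + hother

theorem IsDecisionPoint.mem_osla_iff (hd : IsDecisionPoint N h) (hl : nStar N ≤ h.length) :
    h ∈ osla N ↔ q N (h.length + 1) ≤ p N h := by
  have hN := hd.length_lt hl
  have hN0 : (0 : ℝ) < N := by exact_mod_cast hN.pos
  rw [q_le_iff (Nat.lt_succ_of_le hl) hN, osla, Set.mem_ofPred_eq, and_iff_right hd.2,
    hd.nextReward_eq hl, hd.stopReward_eq hl]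
  exact mul_le_mul_iff_of_pos_left (by positivity)

theorem IsDecisionPoint.mem_osla_of_prefix (hd : IsDecisionPoint N h) (hl : nStar N ≤ h.length)
    (hd' : IsDecisionPoint N h') (hp : h <+: h') (ho : h ∈ osla N) : h' ∈ osla N := by
  rcases eq_or_ne h h' with rfl | hne
  · exact ho
  have hlen : h.length < h'.length := hp.length_le.lt_of_ne (mt hp.eq_of_length hne)
  have hl' := hl.trans hlen.le
  rw [hd.mem_osla_iff hl] at ho
  rw [hd'.mem_osla_iff hl']
  calc q N (h'.length + 1)
      ≤ q N (h.length + 1) := (q_strictAntiOn N ⟨Nat.lt_succ_of_le hl, hd.length_lt hl⟩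
        ⟨Nat.lt_succ_of_le hl', hd'.length_lt hl'⟩ (Nat.succ_lt_succ hlen)).le
    _ ≤ p N h := ho
    _ ≤ p N h' := (hd.p_lt hl hd' hp hne).le

end DecisionPoint

/-! ### Backward induction -/

section Value

variable {σ τ : Strategy} {k : ℕ} {h : List ℕ}

theorem value_of_mem (hσ : h ∈ σ) : value N σ h.length h = stopReward N h := by
  refine condProb_congr fun ω hω => ⟨?_, fun hbest => ?_⟩
  · rintro ⟨i, hi, -, -, hnot, hbest⟩
    rcases hi.eq_or_lt with rfl | hlt
    · exact hbest
    · exact absurd (hω.2.symm ▸ hσ) (hnot _ le_rfl hlt)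
  · exact ⟨h.length, le_rfl, hω.1, hω.2.symm ▸ hσ, fun l hl hl' => absurd hl' hl.not_gt, hbest⟩

theorem value_of_notMem (hσ : h ∉ σ) :
    value N σ h.length h = value N σ (h.length + 1) h := by
  refine condProb_congr fun ω hω => exists_congr fun i => ?_
  have hnot : hist ω h.length ∉ σ := hω.2.symm ▸ hσ
  constructor
  · rintro ⟨hi, hiN, hmem, hbefore, hbest⟩
    have hne : h.length ≠ i := fun hi => hnot (hi ▸ hmem)
    exact ⟨hi.lt_of_ne hne, hiN, hmem, fun l hl => hbefore l (by omega), hbest⟩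
  · rintro ⟨hi, hiN, hmem, hbefore, hbest⟩
    refine ⟨by omega, hiN, hmem, fun l hl hli => ?_, hbest⟩
    rcases hl.eq_or_lt with rfl | hlt
    · exact hnot
    · exact hbefore l hlt hli

theorem WinsFrom.congr (hστ : ∀ l, k ≤ l → l ≤ numSeen ω → (hist ω l ∈ σ ↔ hist ω l ∈ τ))
    (hwins : WinsFrom σ k ω) : WinsFrom τ k ω := by
  obtain ⟨i, hi, hiN, hmem, hbefore, hbest⟩ := hwins
  exact ⟨i, hi, hiN, (hστ i hi hiN).1 hmem,
    fun l hl hli => mt (hστ l hl (hli.le.trans hiN)).2 (hbefore l hl hli), hbest⟩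

theorem value_congr (hk : h.length ≤ k) (hστ : ∀ g, h <+: g → k ≤ g.length →
    (event N g).Nonempty → (g ∈ σ ↔ g ∈ τ)) : value N σ k h = value N τ k h := by
  refine condProb_congr fun ω hω => ?_
  have hhist (l : ℕ) (hl : k ≤ l) (hlN : l ≤ numSeen ω) : hist ω l ∈ σ ↔ hist ω l ∈ τ := by
    refine hστ _ ?_ (by rwa [length_hist]) ⟨ω, by rwa [length_hist], by rw [length_hist]⟩
    have hprefix := hist_prefix_hist ω (hk.trans hl)
    rwa [hω.2] at hprefix
  exact ⟨WinsFrom.congr hhist, WinsFrom.congr fun l hl hlN => (hhist l hl hlN).symm⟩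

theorem ncard_winsFrom_inter_event (σ : Strategy) (h : List ℕ) :
    ({ω | WinsFrom σ (h.length + 1) ω} ∩ event N h).ncard =
      ∑ r ∈ range (N + 1),
        ({ω | WinsFrom σ (h.length + 1) ω} ∩ event N (h ++ [r])).ncard := by
  rw [← Set.inter_eq_left.2 (show {ω | WinsFrom σ (h.length + 1) ω} ∩ event N h ⊆
    {ω | seenRank ω (h.length + 1) ∈ range (N + 1)} from ?_), ncard_inter_mem_eq_sum]
  · refine sum_congr rfl fun r _ => congrArg _ (Set.ext fun ω => ?_)
    simp only [Set.inter_assoc, Set.mem_inter_iff, Set.mem_ofPred_eq, mem_event_concat]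
    refine and_congr_right fun hwins => and_congr_right fun _ => ?_
    obtain ⟨i, hi, hiN, -⟩ := hwins
    exact (and_iff_right (by omega)).symm
  · rintro ω ⟨⟨i, hi, hiN, -⟩, -⟩
    have hle := seenRank_le ω (h.length + 1)
    have hnum := numSeen_le ω
    exact mem_range.2 (by omega)

theorem value_succ_mono (hle : ∀ r, value N σ (h.length + 1) (h ++ [r]) ≤
      value N τ (h.length + 1) (h ++ [r])) :
    value N σ (h.length + 1) h ≤ value N τ (h.length + 1) h := by
  rw [value, condProb, value, condProb]
  gcongr ?_ / _
  rw [ncard_winsFrom_inter_event, ncard_winsFrom_inter_event]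
  push_cast
  refine sum_le_sum fun r _ => ?_
  rcases (event N (h ++ [r])).eq_empty_or_nonempty with hempty | hne
  · simp [hempty]
  · have hpos : (0 : ℝ) < (event N (h ++ [r])).ncard := by
      exact_mod_cast (Set.ncard_pos (Set.toFinite _)).2 hne
    exact (div_le_div_iff_of_pos_right hpos).1 (hle r)

theorem value_of_lt (hN : N < h.length) : value N σ k h = 0 := by
  have hempty : event N h = ∅ := Set.eq_empty_of_forall_notMem fun ω hω =>
    (hω.1.trans (numSeen_le ω)).not_gt hN
  simp [value, condProb, hempty]

theorem backward_induction {P : List ℕ → Prop} (N : ℕ) (hlong : ∀ h, N < h.length → P h)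
    (hstep : ∀ h, (∀ r, P (h ++ [r])) → P h) (h : List ℕ) : P h := by
  rcases lt_or_ge N h.length with hlt | _
  · exact hlong h hlt
  · exact hstep h fun r => backward_induction N hlong hstep (h ++ [r])
termination_by N + 1 - h.length
decreasing_by rw [List.length_append, List.length_singleton]; omega

end Value

/-! ### Optimality of the one-step look-ahead rule -/

section Optimality

variable {h : List ℕ}

theorem stopReward_le_nextReward (h1 : 1 ≤ h.length) (ho : h ∉ osla N) :
    stopReward N h ≤ nextReward N h := by
  by_cases hc : EndsWithCandidate h
  · exact (not_le.1 fun hle => ho ⟨hc, hle⟩).le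
  · have hlose : stopReward N h = condProb ∅ (event N h) := condProb_congr fun ω hω => by
      refine iff_of_false (fun hbest => hc ?_) (Set.notMem_empty ω)
      rw [← hω.2, endsWithCandidate_hist h1]
      exact seenRank_eq_one_of_absRank h1 hω.1 hbest
    rw [hlose, condProb, Set.empty_inter, Set.ncard_empty, Nat.cast_zero, zero_div]
    exact condProb_nonneg _ _

theorem value_osla_succ_le_stopReward (hl : nStar N ≤ h.length) (ho : h ∈ osla N) :
    value N (osla N) (h.length + 1) h ≤ stopReward N h := by
  refine le_of_eq_of_le (value_congr h.length.le_succ fun g hp _ hne => ?_) ho.2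
  refine ⟨fun hg => hg.1, fun hg => ?_⟩
  have hd : IsDecisionPoint N h := ⟨hne.mono (event_subset_event_of_prefix hp), ho.1⟩
  exact hd.mem_osla_of_prefix hl ⟨hne, hg⟩ hp ho

theorem value_le_value_osla (hN : 1 ≤ N) (hl : nStar N ≤ h.length) (σ : Strategy) :
    value N σ h.length h ≤ value N (osla N) h.length h := by
  induction h using backward_induction N generalizing σ with
  | hlong h hlt => rw [value_of_lt hlt, value_of_lt hlt]
  | hstep h ih =>
    have hsucc (τ : Strategy) :
        value N τ (h.length + 1) h ≤ value N (osla N) (h.length + 1) h :=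
      value_succ_mono fun r => by simpa using ih r (hl.trans (by simp)) τ
    by_cases ho : h ∈ osla N <;> by_cases hσ : h ∈ σ
    · rw [value_of_mem hσ, value_of_mem ho]
    · rw [value_of_notMem hσ, value_of_mem ho]
      exact (hsucc σ).trans (value_osla_succ_le_stopReward hl ho)
    · rw [value_of_mem hσ, value_of_notMem ho]
      exact (stopReward_le_nextReward ((one_le_nStar hN).trans hl) ho).trans (hsucc _)
    · rw [value_of_notMem hσ, value_of_notMem ho]
      exact hsucc σ

theorem value_succ_le_stopReward (hN : 1 ≤ N) (hl : nStar N ≤ h.length) (ho : h ∈ osla N)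
    (σ : Strategy) : value N σ (h.length + 1) h ≤ stopReward N h :=
  (value_succ_mono fun r => by
    simpa using value_le_value_osla hN (h := h ++ [r]) (hl.trans (by simp)) σ).trans
      (value_osla_succ_le_stopReward hl ho)

theorem value_length_le_value_thenOsla (hN : 1 ≤ N) (σ : Strategy) (h : List ℕ) :
    value N σ h.length h ≤ value N (thenOsla N σ) h.length h := by
  induction h using backward_induction N with
  | hlong h hlt => rw [value_of_lt hlt, value_of_lt hlt]
  | hstep h ih =>
    rcases lt_or_ge h.length (nStar N) with hlt | hge
    · have hmem : h ∈ thenOsla N σ ↔ h ∈ σ := by simp [thenOsla, hlt, hlt.not_ge]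
      by_cases hσ : h ∈ σ
      · rw [value_of_mem hσ, value_of_mem (hmem.2 hσ)]
      · rw [value_of_notMem hσ, value_of_notMem (hmem.not.2 hσ)]
        exact value_succ_mono fun r => by simpa using ih r
    · refine (value_le_value_osla hN hge σ).trans_eq (value_congr le_rfl fun g _ hg _ => ?_)
      have hgl := hge.trans hg
      simp [thenOsla, hgl, hgl.not_gt]

theorem value_le_value_thenOsla (hN : 1 ≤ N) (σ : Strategy) :
    value N σ 1 [] ≤ value N (thenOsla N σ) 1 [] :=
  value_succ_mono (h := []) fun r => by simpa using value_length_le_value_thenOsla hN σ [r]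

end Optimality

end SecretaryGame

theorem lemma1 (N : ℕ) (hN : 1 ≤ N) :
    -- at a decision point after moment `n*` Player 2 knows the moment: it is `h.length + 1`
    (∀ h : List ℕ, SecretaryGame.nStar N ≤ h.length → SecretaryGame.IsDecisionPoint N h →
      ∀ ω ∈ SecretaryGame.event N h,
        SecretaryGame.seenAt ω h.length = h.length + 1 ∧ h.length + 1 ≤ N) ∧
    -- the thresholds decrease
    (∀ n n' : ℕ, SecretaryGame.nStar N < n → n < n' → n' ≤ N →
      SecretaryGame.q N n' < SecretaryGame.q N n) ∧
    -- the one-step look-ahead rule accepts a candidate at moment `n` iff `p ≥ q_n`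
    (∀ h : List ℕ, SecretaryGame.nStar N ≤ h.length → SecretaryGame.IsDecisionPoint N h →
      (h ∈ SecretaryGame.osla N ↔
        SecretaryGame.q N (h.length + 1) ≤ SecretaryGame.p N h)) ∧
    -- along later decision points `p` increases and the stopping sets are closed
    (∀ h h' : List ℕ, SecretaryGame.nStar N ≤ h.length → SecretaryGame.IsDecisionPoint N h →
      SecretaryGame.IsDecisionPoint N h' → h <+: h' → h ≠ h' →
        SecretaryGame.p N h < SecretaryGame.p N h' ∧
        (h ∈ SecretaryGame.osla N → h' ∈ SecretaryGame.osla N)) ∧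
    -- optimality of the one-step look-ahead rule given any history from `n*` on
    (∀ h : List ℕ, SecretaryGame.nStar N ≤ h.length → ∀ σ : SecretaryGame.Strategy,
      SecretaryGame.value N σ h.length h ≤
        SecretaryGame.value N (SecretaryGame.osla N) h.length h) ∧
    -- accepting is optimal (no continuation after rejection does better) iff `p ≥ q_n`
    (∀ h : List ℕ, SecretaryGame.nStar N ≤ h.length → SecretaryGame.IsDecisionPoint N h →
      ((∀ σ : SecretaryGame.Strategy,
          SecretaryGame.value N σ (h.length + 1) h ≤ SecretaryGame.stopReward N h) ↔
        SecretaryGame.q N (h.length + 1) ≤ SecretaryGame.p N h)) ∧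
    -- in the whole game, switching to the one-step look-ahead rule at `n*` never hurts
    (∀ σ : SecretaryGame.Strategy,
      SecretaryGame.value N σ 1 [] ≤
        SecretaryGame.value N (SecretaryGame.thenOsla N σ) 1 []) := by
  refine ⟨fun h hl hd ω hω => ?seen, fun n n' hn hlt hn' => ?antitone,
    fun h hl hd => hd.mem_osla_iff hl, fun h h' hl hd hd' hp hne =>
      ⟨hd.p_lt hl hd' hp hne, hd.mem_osla_of_prefix hl hd' hp⟩,
    fun h hl => SecretaryGame.value_le_value_osla hN hl, fun h hl hd => ?optimal,
    SecretaryGame.value_le_value_thenOsla hN⟩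
  case seen => exact ⟨SecretaryGame.seenAt_of_le (hd.2.afterPick hl ω hω), hd.length_lt hl⟩
  case antitone =>
    exact SecretaryGame.q_strictAntiOn N ⟨hn, by omega⟩ ⟨by omega, hn'⟩ hlt
  case optimal =>
    rw [← hd.mem_osla_iff hl]
    exact ⟨fun hall => ⟨hd.2, hall _⟩, SecretaryGame.value_succ_le_stopReward hN hl⟩
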